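/- Let $\mathbb K=\mathbb R$ or $\mathbb C$. For $k\ge 0$ let $\mathcal D_k=\mathcal D(\mathbb R^k,\mathbb K)$ be the space of smooth compactly supported functions $\mathbb R^k\to\mathbb K$ with its canonical LF topology, and let $\mathcal D_k'$ be its topological dual, the space of distributions on $\mathbb R^k$. Let $v=(v_p)_{p\in\mathbb R^m}$ be a family in $\mathcal D_n'$ that is a $\mathcal D$-family: for each $\phi\in\mathcal D_n$ the function $v(\phi):\mathbb R^m\to\mathbb K$, $v(\phi)(p):=v_p(\phi)$, belongs to $\mathcal D_m$. Let $\widehat v:\mathcal D_n\to\mathcal D_m$ be the linear operator $\phi\mapsto v(\phi)$. **Theorem.** The following four assertions all hold, and they are equivalent: 1. for every $a\in\mathcal D_m'$ the functional $a\circ\widehat v:\mathcal D_n\to\mathbb K$, $\phi\mapsto a(\widehat v(\phi))$, is a distribution, i.e. belongs to $\mathcal D_n'$; 2. $\widehat v$ is transposable, i.e. its algebraic transpose $f\mapsto f\circ\widehat v$ restricts to a linear operator $\mathcal D_m'\to\mathcal D_n'$ between the topological duals; 3. $\widehat v$ is weakly continuous, i.e. continuous from $\mathcal D_n$ with $\sigma(\mathcal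 D_n,\mathcal D_n')$ to $\mathcal D_m$ with $\sigma(\mathcal D_m,\mathcal D_m')$; 4. $\widehat v$ is strongly continuous, i.e. continuous from $\mathcal D_n$ to $\mathcal D_m$ with their canonical LF topologies. -/

import Mathlib

open scoped Distributions

/-- `TestSpace 𝕂 n` is the space `𝒟ₙ` of smooth compactly supported functions `ℝⁿ → 𝕂`,
with its canonical LF topology. -/
abbrev TestSpace (𝕂 : Type*) [RCLike 𝕂] (n : ℕ) : Type _ :=
  𝓓((⊤ : TopologicalSpace.Opens (EuclideanSpace ℝ (Fin n))), 𝕂)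

/-- `DistSpace 𝕂 n` is the space `𝒟'ₙ` of `𝕂`-valued distributions on `ℝⁿ`: the continuous
`𝕂`-linear functionals on `𝒟ₙ`. -/
abbrev DistSpace (𝕂 : Type*) [RCLike 𝕂] (n : ℕ) : Type _ :=
  StrongDual 𝕂 (TestSpace 𝕂 n)

section Families

variable {𝕂 : Type*} [RCLike 𝕂] {m n : ℕ}

/-- The image `v(φ) : ℝᵐ → 𝕂`, `p ↦ v_p(φ)`, of a test function `φ` by a family `v` of
distributions indexed by `ℝᵐ`. -/
noncomputable def familyImage (v : EuclideanSpace ℝ (Fin m) → DistSpace 𝕂 n) (φ : TestSpace 𝕂 n) :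
    EuclideanSpace ℝ (Fin m) → 𝕂 :=
  fun p => v p φ

/-- `v` is a `𝒟`-family if `v(φ)` belongs to `𝒟ₘ` for each `φ ∈ 𝒟ₙ`. -/
def IsDFamily (v : EuclideanSpace ℝ (Fin m) → DistSpace 𝕂 n) : Prop :=
  ∀ φ : TestSpace 𝕂 n, ∃ ψ : TestSpace 𝕂 m, (ψ : EuclideanSpace ℝ (Fin m) → 𝕂) = familyImage v φ

/-- The linear operator `v̂ : 𝒟ₙ → 𝒟ₘ`, `φ ↦ v(φ)`, associated with a `𝒟`-family `v`. -/
noncomputable def IsDFamily.operator {v : EuclideanSpace ℝ (Fin m) → DistSpace 𝕂 n} (hv : IsDFamily v) :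
    TestSpace 𝕂 n →ₗ[𝕂] TestSpace 𝕂 m where
  toFun φ :=
    { toFun := familyImage v φ
      contDiff' := by
        obtain ⟨ψ, hψ⟩ := hv φ
        exact hψ ▸ ψ.contDiff
      hasCompactSupport' := by
        obtain ⟨ψ, hψ⟩ := hv φ
        exact hψ ▸ ψ.hasCompactSupport
      tsupport_subset' := fun _ _ => trivial }
  map_add' φ₁ φ₂ := TestFunction.ext fun p => map_add (v p) φ₁ φ₂
  map_smul' c φ := TestFunction.ext fun p => map_smul (v p) c φ

theorem IsDFamily.operator_apply {v : EuclideanSpace ℝ (Fin m) → DistSpace 𝕂 n}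
    (hv : IsDFamily v) (φ : TestSpace 𝕂 n) (p : EuclideanSpace ℝ (Fin m)) :
    hv.operator φ p = v p φ :=
  rfl

end Families

/-- A linear operator `A : E → F` is transposable if its algebraic transpose `f ↦ f ∘ A` maps
the topological dual of `F` into the topological dual of `E`, that is, restricts to a linear
operator `ᵗA : F' → E'`. -/
def IsTransposable {𝕂 E F : Type*} [RCLike 𝕂]
    [AddCommGroup E] [Module 𝕂 E] [TopologicalSpace E]
    [AddCommGroup F] [Module 𝕂 F] [TopologicalSpace F] (A : E →ₗ[𝕂] F) : Prop :=
  ∃ B : StrongDual 𝕂 F →ₗ[𝕂] StrongDual 𝕂 E,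
    ∀ a : StrongDual 𝕂 F, (B a : E →ₗ[𝕂] 𝕂) = A.dualMap (a : F →ₗ[𝕂] 𝕂)

/-- `A : E → F` is weakly continuous if it is continuous from `E` with the weak topology
`σ(E, E')` to `F` with the weak topology `σ(F, F')`. -/
def IsWeaklyContinuous {𝕂 E F : Type*} [RCLike 𝕂]
    [AddCommGroup E] [Module 𝕂 E] [TopologicalSpace E]
    [AddCommGroup F] [Module 𝕂 F] [TopologicalSpace F] (A : E →ₗ[𝕂] F) : Prop :=
  Continuous fun x : WeakSpace 𝕂 E => toWeakSpace 𝕂 F (A ((toWeakSpace 𝕂 E).symm x))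

open Set Filter Topology TopologicalSpace
open scoped BoundedContinuousFunction ContDiff

section Completeness

variable {E F : Type*} [NormedAddCommGroup E] [NormedSpace ℝ E]
  [NormedAddCommGroup F] [NormedSpace ℝ F]

/-! Strong continuity holds outright and yields the other assertions by composing with functionals.
By the LF property it suffices to treat each `𝓓_{K}`, a Fréchet space, hence Baire and barrelled.
Baire's theorem confines all images of `𝓓_{K}` to one ball `L` (`IsDFamily.exists_common_support`).
Continuity into `𝓓_{L}` follows from continuity of each `v p` by two uses of barrelledness:
derivatives at a point are limits of difference quotients, and suprema of pointwise bounded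
continuous seminorms are continuous. -/

/-- A uniform limit of smooth functions, all of whose derivatives converge uniformly, is smooth,
and its derivatives are the limits of the derivatives. -/
theorem hasFTaylorSeriesUpTo_of_tendstoUniformly {ι : Type*} {l : Filter ι} [l.NeBot]
    {f : ι → E → F} (hf : ∀ k, ContDiff ℝ ∞ (f k)) {g : E → FormalMultilinearSeries ℝ E F}
    (hg : ∀ i : ℕ, TendstoUniformly (fun k => iteratedFDeriv ℝ i (f k)) (fun x => g x i) l) :
    HasFTaylorSeriesUpTo ∞ (fun x => (g x 0).curry0) g := by
  rw [hasFTaylorSeriesUpTo_top_iff' (by simp)]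
  refine ⟨fun _ => rfl, fun i x => ?_⟩
  let A := (continuousMultilinearCurryLeftEquiv ℝ (fun _ : Fin (i + 1) => E) F)
  refine hasFDerivAt_of_tendstoUniformly (l := l) (f := fun k => iteratedFDeriv ℝ i (f k))
    (f' := fun k x => (iteratedFDeriv ℝ (i + 1) (f k) x).curryLeft)
    (A.isometry.uniformContinuous.comp_tendstoUniformly (hg (i + 1))) (fun k x => ?_)
    (fun x => (hg i).tendsto_at x) x
  exact (hf k).ftaylorSeries.fderiv i (mod_cast ENat.natCast_lt_top i) x

namespace ContDiffMapSupportedIn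

instance instCompleteSpace [CompleteSpace F] {K : Compacts E} : CompleteSpace 𝓓_{K}(E, F) := by
  have hemb := isUniformEmbedding_pi_structureMapCLM ℝ (n := ⊤) (K := K) (E := E) (F := F)
  rw [completeSpace_iff_isComplete_range hemb.isUniformInducing]
  -- The ambient product of spaces of bounded continuous functions is countable, so sequences detect
  -- closedness.
  refine IsClosed.isComplete (IsSeqClosed.isClosed ?_)
  intro u G hu hG
  choose f hf using hu
  have hlim (i : ℕ) : TendstoUniformly (fun k => iteratedFDeriv ℝ i (f k)) (G i) atTop := by
    have := BoundedContinuousFunction.tendsto_iff_tendstoUniformly.1 ((tendsto_pi_nhds.1 hG) i)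
    simpa only [← hf, ContinuousLinearMap.pi_apply, structureMapCLM_top_apply] using this
  have hT := hasFTaylorSeriesUpTo_of_tendstoUniformly (g := fun x i => G i x)
    (fun k => (f k).contDiff) hlim
  refine ⟨⟨_, hT.contDiff, fun x hx => ?_⟩, ?_⟩
  · have h0 : ∀ k, iteratedFDeriv ℝ 0 (f k) x = 0 := fun k =>
      (f k).iteratedFDeriv_zero_on_compl hx
    have : G 0 x = 0 := tendsto_nhds_unique ((hlim 0).tendsto_at x) (by simp [h0])
    simp [this]
  · funext i
    ext1 x
    rw [ContinuousLinearMap.pi_apply, structureMapCLM_top_apply]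
    exact (hT.eq_iteratedFDeriv (mod_cast le_top) x).symm

/-- Serves twice: for the common support, and for the barrelledness behind Banach-Steinhaus. -/
instance instBaireSpace [CompleteSpace F] {K : Compacts E} : BaireSpace 𝓓_{K}(E, F) := by
  have hcg : (uniformity 𝓓_{K}(E, F)).IsCountablyGenerated := by
    rw [← (isUniformEmbedding_pi_structureMapCLM ℝ (n := ⊤) (K := K)).comap_uniformity]
    infer_instance
  let := UniformSpace.pseudoMetricSpace 𝓓_{K}(E, F)
  infer_instance

end ContDiffMapSupportedIn

end Completeness

section PointwiseContinuous

variable {X E F : Type*} [AddCommGroup X] [Module ℝ X] [UniformSpace X]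
  [IsUniformAddGroup X] [ContinuousSMul ℝ X] [BarrelledSpace ℝ X]
  [NormedAddCommGroup E] [NormedSpace ℝ E] [FiniteDimensional ℝ E]
  [NormedAddCommGroup F] [NormedSpace ℝ F]

/-- By the Banach-Steinhaus theorem, if a linear map from a barrelled space to a space of
differentiable functions is continuous for pointwise convergence, so is its derivative. -/
theorem continuous_fderiv_apply_of_continuous_apply (T : X →ₗ[ℝ] E → F)
    (hd : ∀ x, Differentiable ℝ (T x)) (hT : ∀ p, Continuous fun x => T x p) (p : E) :
    Continuous fun x => fderiv ℝ (T x) p := by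
  refine continuous_clm_apply.2 fun e => ?_
  obtain ⟨Q, hQ⟩ : ∃ Q : ℕ → X →L[ℝ] F,
      Tendsto (fun k x => Q k x) atTop (𝓝 fun x => fderiv ℝ (T x) p e) := by
    -- Difference quotients with step `1/k`; the junk term `k = 0` is zero.
    refine ⟨fun k =>
      { toFun := fun x => (k : ℝ) • (T x (p + (k : ℝ)⁻¹ • e) - T x p)
        map_add' := fun x y => by simp only [map_add, Pi.add_apply]; module
        map_smul' := fun c x => by simp only [map_smul, Pi.smul_apply, RingHom.id_apply]; module
        cont := ((hT _).sub (hT _)).const_smul _ }, tendsto_pi_nhds.2 fun x => ?_⟩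
    exact ((hd x p).hasFDerivAt.lim_real e).comp tendsto_natCast_atTop_atTop
  exact (continuousLinearMapOfTendsto Q hQ).continuous

theorem continuous_iteratedFDeriv_apply_of_continuous_apply (T : X →ₗ[ℝ] E → F)
    (hd : ∀ x, ContDiff ℝ ∞ (T x)) (hT : ∀ p, Continuous fun x => T x p) (i : ℕ) (p : E) :
    Continuous fun x => iteratedFDeriv ℝ i (T x) p := by
  induction i generalizing p with
  | zero =>
    simp only [iteratedFDeriv_zero_eq_comp, Function.comp_apply]
    exact (LinearIsometryEquiv.continuous _).comp (hT p)
  | succ i ih =>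
    let D : X →ₗ[ℝ] E → E [×i]→L[ℝ] F :=
      { toFun := fun x => iteratedFDeriv ℝ i (T x)
        map_add' := fun x y => by
          funext p
          rw [map_add, Pi.add_apply]
          exact iteratedFDeriv_add_apply ((hd x).of_le (mod_cast le_top)).contDiffAt
            ((hd y).of_le (mod_cast le_top)).contDiffAt
        map_smul' := fun c x => by
          funext p
          rw [map_smul, Pi.smul_apply, RingHom.id_apply]
          exact iteratedFDeriv_const_smul_apply ((hd x).of_le (mod_cast le_top)).contDiffAt }
    have h := continuous_fderiv_apply_of_continuous_apply D
      (fun x => (hd x).differentiable_iteratedFDeriv (mod_cast ENat.natCast_lt_top i)) ih p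
    simp only [iteratedFDeriv_succ_eq_comp_left, Function.comp_apply]
    exact (LinearIsometryEquiv.continuous _).comp h

/-- A linear map from a barrelled space to `𝓓_{L}(E, F)` which is continuous for pointwise
convergence is continuous. -/
theorem ContDiffMapSupportedIn.continuous_of_continuous_apply {L : Compacts E}
    (T : X →ₗ[ℝ] 𝓓_{L}(E, F)) (hT : ∀ p, Continuous fun x => T x p) : Continuous T := by
  refine WithSeminorms.continuous_of_continuous_comp
    (ContDiffMapSupportedIn.withSeminorms ℝ E F ⊤ L) T fun i => ?_
  let D (p : E) : X →ₗ[ℝ] E [×i]→L[ℝ] F :=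
    { toFun := fun x => structureMapLM ℝ ⊤ i (T x) p
      map_add' := fun x y => by simp
      map_smul' := fun c x => by simp }
  have hD (p : E) (x : X) : D p x = iteratedFDeriv ℝ i (T x) p :=
    congrFun (structureMapLM_top_apply ℝ (T x)) p
  have hDc (p : E) : Continuous (D p) := by
    have := continuous_iteratedFDeriv_apply_of_continuous_apply
      { toFun := fun x => (T x : E → F)
        map_add' := fun x y => by ext; simp
        map_smul' := fun c x => by ext; simp } (fun x => (T x).contDiff) hT i p
    exact this.congr fun x => (hD p x).symm
  let q (p : E) : Seminorm ℝ X := (normSeminorm ℝ (E [×i]→L[ℝ] F)).comp (D p)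
  have hle (p : E) (x : X) : q p x ≤ N[ℝ]_{L, i} (T x) := by
    change ‖D p x‖ ≤ _
    rw [hD]
    exact norm_iteratedFDeriv_apply_le_seminorm_top ℝ
  have hbdd : BddAbove (range q) :=
    ⟨(N[ℝ]_{L, i}).comp T, by rintro _ ⟨p, rfl⟩ x; exact hle p x⟩
  -- Barrelledness enters here; the bound `hbdd` is only pointwise in `x`, with no continuity of `T`
  -- assumed.
  have hsup := Seminorm.continuous_iSup q (fun p => (hDc p).norm) hbdd
  rw [← Seminorm.coe_iSup_eq hbdd] at hsup
  refine Seminorm.continuous_of_le hsup fun x => ?_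
  refine (ContDiffMapSupportedIn.seminorm_top_le_iff ℝ (apply_nonneg _ _) i (T x)).2 fun p _ => ?_
  rw [← hD]
  exact le_ciSup hbdd p x

end PointwiseContinuous

section Operator

variable {𝕂 : Type*} [RCLike 𝕂] {m n : ℕ}

/-- A `𝒟`-family maps the test functions supported in a fixed compact set to test functions
supported in a common ball. -/
theorem IsDFamily.exists_common_support {v : EuclideanSpace ℝ (Fin m) → DistSpace 𝕂 n}
    (hv : IsDFamily v) (K : Compacts (EuclideanSpace ℝ (Fin n))) :
    ∃ j : ℕ, ∀ φ : 𝓓_{K}(EuclideanSpace ℝ (Fin n), 𝕂), ∀ p ∉ Metric.closedBall 0 (j : ℝ),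
      v p (TestFunction.ofSupportedIn (subset_univ _) φ) = 0 := by
  let ι := TestFunction.ofSupportedInCLM 𝕂 (n := ⊤) (F := 𝕂) (K := K) (Ω := ⊤) (subset_univ _)
  let S (j : ℕ) : Submodule 𝕂 𝓓_{K}(EuclideanSpace ℝ (Fin n), 𝕂) :=
    ⨅ p ∈ (Metric.closedBall (0 : EuclideanSpace ℝ (Fin m)) (j : ℝ))ᶜ,
      LinearMap.ker ((v p).comp ι).toLinearMap
  have hmem (j : ℕ) (φ) : φ ∈ S j ↔ ∀ p ∉ Metric.closedBall 0 (j : ℝ), v p (ι φ) = 0 := by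
    simp [S]
  have hclosed (j : ℕ) : IsClosed (S j : Set 𝓓_{K}(EuclideanSpace ℝ (Fin n), 𝕂)) := by
    have : (S j : Set 𝓓_{K}(EuclideanSpace ℝ (Fin n), 𝕂)) =
        ⋂ p ∈ (Metric.closedBall (0 : EuclideanSpace ℝ (Fin m)) (j : ℝ))ᶜ,
          {φ | v p (ι φ) = 0} := by
      ext φ
      simp [hmem]
    rw [this]
    exact isClosed_biInter fun p _ => isClosed_eq ((v p).comp ι).continuous continuous_const
  have hcover : ⋃ j, (S j : Set 𝓓_{K}(EuclideanSpace ℝ (Fin n), 𝕂)) = univ := by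
    refine eq_univ_of_forall fun φ => mem_iUnion.2 ?_
    obtain ⟨R, hR⟩ := (hv.operator (ι φ)).hasCompactSupport.isBounded.subset_closedBall 0
    obtain ⟨j, hj⟩ := exists_nat_ge R
    refine ⟨j, (hmem j φ).2 fun p hp => ?_⟩
    exact image_eq_zero_of_notMem_tsupport (f := hv.operator (ι φ)) fun h =>
      hp (Metric.closedBall_subset_closedBall hj (hR h))
  obtain ⟨j, hj⟩ := nonempty_interior_of_iUnion_of_closed hclosed hcover
  -- A subspace with nonempty interior is the whole space.
  have htop := (S j).eq_top_of_nonempty_interior' hj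
  exact ⟨j, fun φ => (hmem j φ).1 (htop ▸ Submodule.mem_top)⟩

/-- The operator associated with a `𝒟`-family is continuous for the LF topologies. -/
theorem IsDFamily.continuous_operator {v : EuclideanSpace ℝ (Fin m) → DistSpace 𝕂 n}
    (hv : IsDFamily v) : Continuous hv.operator := by
  rw [TestFunction.continuous_iff_continuous_comp]
  intro K hK
  obtain ⟨j, hj⟩ := hv.exists_common_support K
  let L : Compacts (EuclideanSpace ℝ (Fin m)) := ⟨_, isCompact_closedBall 0 (j : ℝ)⟩
  let ι := TestFunction.ofSupportedInCLM 𝕂 (n := ⊤) (F := 𝕂) hK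
  let T : 𝓓_{K}(EuclideanSpace ℝ (Fin n), 𝕂) →ₗ[ℝ] 𝓓_{L}(EuclideanSpace ℝ (Fin m), 𝕂) :=
    { toFun := fun φ => ⟨hv.operator (ι φ), (hv.operator (ι φ)).contDiff, fun p hp => hj φ p hp⟩
      map_add' := fun φ ψ => by
        ext p
        exact congrArg (fun χ : TestSpace 𝕂 m => χ p)
          ((congrArg hv.operator (map_add ι φ ψ)).trans (map_add hv.operator _ _))
      map_smul' := fun c φ => by
        ext p
        exact congrArg (fun χ : TestSpace 𝕂 m => χ p)
          (map_smul (hv.operator.restrictScalars ℝ) c (ι φ)) }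
  have hT : Continuous T := ContDiffMapSupportedIn.continuous_of_continuous_apply T
    fun p => ((v p).comp ι).continuous
  exact (TestFunction.continuous_ofSupportedIn (K := L) (Ω := ⊤) (subset_univ _)).comp hT

end Operator

theorem mainTheorem2 {𝕂 : Type*} [RCLike 𝕂] {m n : ℕ}
    (v : EuclideanSpace ℝ (Fin m) → DistSpace 𝕂 n) (hv : IsDFamily v) :
    ((∀ a : DistSpace 𝕂 m, ∃ u : DistSpace 𝕂 n, ∀ φ : TestSpace 𝕂 n, u φ = a (hv.operator φ)) ∧
      IsTransposable hv.operator ∧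
      IsWeaklyContinuous hv.operator ∧
      Continuous hv.operator) ∧
    List.TFAE [
      ∀ a : DistSpace 𝕂 m, ∃ u : DistSpace 𝕂 n, ∀ φ : TestSpace 𝕂 n, u φ = a (hv.operator φ),
      IsTransposable hv.operator,
      IsWeaklyContinuous hv.operator,
      Continuous hv.operator] := by
  have hc := hv.continuous_operator
  let A : TestSpace 𝕂 n →L[𝕂] TestSpace 𝕂 m := ⟨hv.operator, hc⟩
  have h1 : ∀ a : DistSpace 𝕂 m, ∃ u : DistSpace 𝕂 n, ∀ φ, u φ = a (hv.operator φ) :=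
    fun a => ⟨a.comp A, fun _ => rfl⟩
  have h2 : IsTransposable hv.operator :=
    ⟨{ toFun := fun a => a.comp A
       map_add' := fun _ _ => rfl
       map_smul' := fun _ _ => rfl }, fun _ => rfl⟩
  -- Testing against `a` after the operator is evaluating `a.comp A`, which is weakly continuous.
  have h3 : IsWeaklyContinuous hv.operator :=
    WeakBilin.continuous_of_continuous_eval _ fun a => WeakBilin.eval_continuous _ (a.comp A)
  refine ⟨⟨h1, h2, h3, hc⟩, ?_⟩
  simp [h1, h2, h3, hc]
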